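/- Let $\overline a=(a_1,\dots,a_\ell)$ be a sequence of nonnegative integers with sum $n$, let $P_{\overline a}$ be the disjoint union of pairwise incomparable chains of sizes $a_1,\dots,a_\ell$, and let $\mathcal L(P_{\overline a})$ be its set of linear extensions $\sigma=[\sigma_1,\dots,\sigma_n]$. Definitions. Replacing each entry of a linear extension by the index of the chain containing it identifies $\mathcal L(P_{\overline a})$ with the set of permutations (rearrangements) of the multiset $\{1^{a_1},\dots,\ell^{a_\ell}\}$. A multiset permutation is written in two-line notation, with its weakly increasing rearrangement as the top line. The intercalation product of two multiset permutations is obtained by juxtaposing their two-line notations and sorting the columns by their top entries without interchanging columns that have the same top entry. A nonempty multiset permutation is a prime cycle if it is not an intercalation product of two nonempty ones. By Foata's theorem every multiset permutation $\sigma$ is an intercalation product of prime cycles, and the number of factors depends only on $\sigma$; this number is $\mathrm{fcyc}(\sigma)$, and for a linear extension $\mathrm{fcyc}$ is that of the corresponding multiset permutation. For a finite poset $P$, a permutation $\tau$ of the elements of $P$ is $P$-transverse if, with $\pi$ denoting the equivalence relation whose classes are the cycles of $\tau$, whenever $i<_P j$ the pair $(j,i)$ is not in the transitive closure of the relation $\{(x,y):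 x\le_P y\}\cup\pi$. Let $\mathrm{cyc}(\tau)$ be the number of cycles of $\tau$, fixed points included. The Poincaré polynomial of $P$ is $$\mathrm{Poin}(P,t)=\sum_X|\mu(V,X)|\,t^{\operatorname{codim}X},$$ where $V=\mathbb R^P$, $X$ runs over the intersections of hyperplanes $\{x_i=x_j\}$ ($i\ne j$ in $P$), including $V$ itself, that meet the open cone $\{x\in V: x_i<x_j\text{ whenever }i<_Pj\}$, and $\mu$ is the Möbius function of the poset of all intersections of these hyperplanes, ordered by reverse inclusion. Theorem. The identification of $\mathcal L(P_{\overline a})$ with the multiset permutations of $\{1^{a_1},\dots,\ell^{a_\ell}\}$ is a bijection, the number $\mathrm{fcyc}(\sigma)$ is well defined for all $\sigma\in\mathcal L(P_{\overline a})$, and there is a bijection $\sigma\mapsto\tau$ from $\mathcal L(P_{\overline a})$ to the set of $P_{\overline a}$-transverse permutations such that $\mathrm{cyc}(\tau)=\mathrm{fcyc}(\sigma)$ for every $\sigma$. Consequently $$\mathrm{Poin}(P_{\overline a},t)=\sum_{\sigma\in\mathcal L(P_{\overline a})}t^{\,n-\mathrm{fcyc}(\sigma)}.$$ -/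

import Mathlib

open Polynomial

noncomputable section

/-! ### Linear hyperplane arrangements, cones and Poincaré polynomials -/

section Arrangement

variable {E : Type*} [AddCommGroup E] [Module ℝ E]

/-- The intersection poset of an arrangement `A` of linear hyperplanes: all intersections of
subfamilies of `A` (the empty intersection being the whole space), ordered by reverse inclusion. -/
def IntersectionPoset (A : Set (Submodule ℝ E)) : Type _ :=
  {X : (Submodule ℝ E)ᵒᵈ // ∃ B ⊆ A, OrderDual.ofDual X = sInf B}

namespace IntersectionPoset

variable {A : Set (Submodule ℝ E)}

instance : PartialOrder (IntersectionPoset A) :=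
  inferInstanceAs (PartialOrder {X : (Submodule ℝ E)ᵒᵈ // ∃ B ⊆ A, OrderDual.ofDual X = sInf B})

/-- The subspace underlying an element of the intersection poset. -/
def space (X : IntersectionPoset A) : Submodule ℝ E := OrderDual.ofDual X.1

/-- The bottom element of the intersection poset: the ambient space. -/
def ambient : IntersectionPoset A :=
  ⟨OrderDual.toDual ⊤, ∅, Set.empty_subset A, by simp⟩

theorem finite (hA : A.Finite) : Finite (IntersectionPoset A) := by
  have : Finite {B : Set (Submodule ℝ E) // B ⊆ A} := hA.finite_subsets.to_subtype
  refine Finite.of_surjective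
    (fun B : {B : Set (Submodule ℝ E) // B ⊆ A} =>
      (⟨OrderDual.toDual (sInf B.1), B.1, B.2, rfl⟩ : IntersectionPoset A)) ?_
  rintro ⟨X, B, hB, hX⟩
  exact ⟨⟨B, hB⟩, Subtype.ext hX.symm⟩

instance [Finite A] : Fintype (IntersectionPoset A) :=
  have := finite (Set.toFinite A)
  Fintype.ofFinite _

instance : DecidableEq (IntersectionPoset A) := Classical.decEq _

instance [Finite A] : LocallyFiniteOrder (IntersectionPoset A) := by
  classical exact Fintype.toLocallyFiniteOrder

/-- The codimension `dim V - dim X`. -/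
def codim (X : IntersectionPoset A) : ℕ := Module.finrank ℝ E - Module.finrank ℝ X.space

end IntersectionPoset

open scoped Classical in
/-- The `k`-th signless Whitney number of a cone `K`: the sum of `|μ(V, X)|` over all `X` of
codimension `k` in the intersection poset of `A` that meet `K`. -/
def whitney (A : Set (Submodule ℝ E)) [Finite A] (K : Set E) (k : ℕ) : ℤ :=
  ∑ X : IntersectionPoset A with ((X.space : Set E) ∩ K).Nonempty ∧ X.codim = k,
    |IncidenceAlgebra.mu ℤ IntersectionPoset.ambient X|

/-- The Poincaré polynomial of a cone `K` of the arrangement `A`. -/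
def poincareCone (A : Set (Submodule ℝ E)) [Finite A] (K : Set E) : ℤ[X] :=
  ∑ k ∈ Finset.range (Module.finrank ℝ E + 1), C (whitney A K k) * X ^ k

end Arrangement

/-! ### Posets: braid cones, linear extensions, transverse permutations -/

section Poset

/-- The hyperplane `x_i = x_j`. -/
def braidHyperplane {P : Type*} (i j : P) : Submodule ℝ (P → ℝ) where
  carrier := {x | x i = x j}
  add_mem' := by
    intro x y hx hy
    change x i + y i = x j + y j
    rw [show x i = x j from hx, show y i = y j from hy]
  zero_mem' := rfl
  smul_mem' := by
    intro c x hx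
    change c • x i = c • x j
    rw [show x i = x j from hx]

/-- The braid arrangement, with coordinates indexed by `P`. -/
def braidArrangement (P : Type*) : Set (Submodule ℝ (P → ℝ)) :=
  {H | ∃ i j : P, i ≠ j ∧ H = braidHyperplane i j}

instance (P : Type*) [Finite P] : Finite (braidArrangement P) := by
  refine Set.Finite.subset
    (Set.finite_range (fun p : P × P => braidHyperplane p.1 p.2)) ?_
  rintro H ⟨i, j, -, rfl⟩
  exact ⟨(i, j), rfl⟩

/-- The open cone of a poset. -/
def posetCone (P : Type*) [PartialOrder P] : Set (P → ℝ) :=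
  {x | ∀ i j : P, i < j → x i < x j}

/-- The Poincaré polynomial of a finite poset. -/
def poin (P : Type*) [Finite P] [PartialOrder P] : ℤ[X] :=
  poincareCone (braidArrangement P) (posetCone P)

/-- Linear extensions `σ = [σ_1, …, σ_n]` of a poset with `n` elements: listings of all its
elements in which smaller elements come first. -/
def LinExt (n : ℕ) (P : Type*) [PartialOrder P] : Type _ :=
  {σ : Fin n ≃ P // ∀ x y : P, x < y → σ.symm x < σ.symm y}

instance (n : ℕ) (P : Type*) [PartialOrder P] : Finite (LinExt n P) :=
  inferInstanceAs (Finite {σ : Fin n ≃ P // ∀ x y : P, x < y → σ.symm x < σ.symm y})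

instance (n : ℕ) (P : Type*) [PartialOrder P] : Fintype (LinExt n P) := Fintype.ofFinite _

/-- A set partition `π` of `P` is `P`-transverse if `i <_P j` implies that `(j, i)` does not lie
in the transitive closure of `P ∪ π`. -/
def IsTransversePartition {P : Type*} [PartialOrder P] (π : Setoid P) : Prop :=
  ∀ i j : P, i < j → ¬ Relation.TransGen (fun x y => x ≤ y ∨ π x y) j i

/-- `P`-transverse permutations: those whose cycles form a `P`-transverse partition. -/
def TransversePerm (P : Type*) [PartialOrder P] : Type _ :=
  {τ : Equiv.Perm P // IsTransversePartition (Equiv.Perm.SameCycle.setoid τ)}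

/-- The number of cycles of a permutation, fixed points included. -/
def cyc {P : Type*} (τ : Equiv.Perm P) : ℕ :=
  Nat.card (Quotient (Equiv.Perm.SameCycle.setoid τ))

end Poset

end

/-! ### Multiset permutations and the intercalation product

A multiset permutation with letters in `Fin ℓ` is a word in these letters; the multiset that it
permutes is the multiset of its letters. -/

section Intercalation

variable {ℓ : ℕ}

/-- The two-line notation, as a list of columns `(top, bottom)`: the top line is the weakly
increasing rearrangement of the word, the bottom line is the word itself. -/
def twoLine (σ : List (Fin ℓ)) : List (Fin ℓ × Fin ℓ) :=
  (σ.insertionSort (· ≤ ·)).zip σ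

/-- The intercalation product: juxtapose the two-line notations, sort the columns stably
by their top entries (insertion sort never interchanges two columns with the same top entry),
and read off the bottom line. -/
def intercalation (σ ρ : List (Fin ℓ)) : List (Fin ℓ) :=
  ((twoLine σ ++ twoLine ρ).insertionSort (fun c d => c.1 ≤ d.1)).map Prod.snd

/-- Prime multiset permutations (the empty one, which is the unit, is not prime). -/
def IsPrimeCycle (σ : List (Fin ℓ)) : Prop :=
  σ ≠ [] ∧ ∀ ρ τ : List (Fin ℓ), σ = intercalation ρ τ → ρ = [] ∨ τ = []

/-- `L = [σ⁽¹⁾, …, σ⁽ᵏ⁾]` is a decomposition of `σ` as an intercalation product of primes. -/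
def IsPrimeDecomposition (σ : List (Fin ℓ)) (L : List (List (Fin ℓ))) : Prop :=
  (∀ c ∈ L, IsPrimeCycle c) ∧ σ = L.foldr intercalation []

/-- The number of prime cycles in a decomposition of `σ` into prime cycles (formally the least such
number; that a decomposition exists and that all have the same number of factors is
Foata's theorem). -/
noncomputable def fcyc (σ : List (Fin ℓ)) : ℕ :=
  sInf {k | ∃ L, IsPrimeDecomposition σ L ∧ L.length = k}

/-- The multiset permutations of the multiset in which `i` has multiplicity `a i`. -/
def multisetPerms (a : Fin ℓ → ℕ) : Set (List (Fin ℓ)) :=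
  {w | ∀ i, w.count i = a i}

/-- The disjoint union of chains of sizes `a i`; elements of different chains are incomparable
(this is the order that a sigma type carries). -/
abbrev ChainUnion (a : Fin ℓ → ℕ) : Type := Σ i : Fin ℓ, Fin (a i)

/-- The multiset permutation of a linear extension: replace each element by the
index of its chain. -/
def multisetWord {n : ℕ} {a : Fin ℓ → ℕ} (σ : LinExt n (ChainUnion a)) : List (Fin ℓ) :=
  List.ofFn (fun k => (σ.1 k).1)

end Intercalation

/-! ### Transverse permutations and height functions -/

section Transverse

variable {P : Type*}

/-! Cut the two-line notation of a word into rows: row `i` lists the bottom entries under the top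
letter `i`. Rows determine the word, and intercalation concatenates them (`row_intercalation`). The
`k`-th element of chain `i` is thought of as the `k`-th place in row `i`.

A prime cycle runs once through distinct letters (`IsPrimeCycle.exists_isMinimalClosed`), so each
factor of a prime decomposition adds at most one entry to each row. Label every element by the
factor that supplies its place. Labels increase strictly along chains, and each factor permutes the
elements with its label in a single cycle. The resulting permutation preserves a strictly increasing
function, hence is transverse (`isTransversePartition_iff`), and its cycles correspond to the
factors.

Its link to the word is `IsRowPerm`: the row entry at `x` names the chain of `τ x`. Every
permutation has such a word, and a transverse permutation is recovered from it by rigidity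
(`perm_eq_of_strictMono_invariant`). This yields both the invariance of the number of factors and
the bijection.

For the Poincaré polynomial, Möbius inversion of sums of signs shows that `|μ(V, X)|` counts the
permutations with fixed space `X`. That space meets the cone exactly when the permutation is
transverse, and its dimension is the number of cycles. -/

theorem comp_perm_eq_of_sameCycle {α : Type*} {τ : Equiv.Perm P} {h : P → α}
    (hτ : ∀ x, h (τ x) = h x) {x y : P} (hxy : τ.SameCycle x y) : h x = h y := by
  have hinv : ∀ z, h (τ⁻¹ z) = h z := fun z => by
    rw [← hτ (τ⁻¹ z)]; simp
  obtain ⟨k, rfl⟩ := hxy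
  induction k using Int.induction_on generalizing x with
  | zero => rfl
  | succ i ih => rw [add_comm, zpow_add, zpow_one, Equiv.Perm.mul_apply, hτ]; exact ih
  | pred i ih =>
    rw [sub_eq_neg_add, zpow_add, zpow_neg_one, Equiv.Perm.mul_apply, hinv]; exact ih

/-- A permutation is transverse iff it leaves invariant some strictly increasing real function. -/
theorem isTransversePartition_iff [Finite P] [PartialOrder P] (τ : Equiv.Perm P) :
    IsTransversePartition (Equiv.Perm.SameCycle.setoid τ) ↔
      ∃ h : P → ℝ, (∀ x, h (τ x) = h x) ∧ StrictMono h := by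
  constructor
  · intro ht
    let r : P → P → Prop := fun x y => x ≤ y ∨ Equiv.Perm.SameCycle.setoid τ x y
    let s : P → Set P := fun x => {y | Relation.ReflTransGen r y x}
    have hs : ∀ x y, r x y → s x ⊆ s y := fun x y hxy z hz => Relation.ReflTransGen.tail hz hxy
    -- The height of `x` counts the elements from which `x` is reachable. It is constant on cycles;
    -- if `x < y`, transversality keeps `y` itself out of `s x`.
    refine ⟨fun x => (s x).ncard, fun x => ?_, fun x y hxy => ?_⟩
    · have h1 : r (τ x) x := Or.inr ⟨-1, by simp⟩
      have h2 : r x (τ x) := Or.inr ⟨1, by simp⟩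
      simp only [(hs _ _ h1).antisymm (hs _ _ h2)]
    · have hlt : s x ⊂ s y := by
        refine (hs _ _ (Or.inl hxy.le)).ssubset_of_mem_notMem
          (a := y) Relation.ReflTransGen.refl fun hy => ?_
        rcases Relation.reflTransGen_iff_eq_or_transGen.1 hy with h | h
        · exact hxy.ne h
        · exact ht x y hxy h
      exact Nat.cast_lt.2 (Set.ncard_lt_ncard hlt (Set.toFinite _))
  · rintro ⟨h, hτ, hmono⟩ i j hij hji
    have : h j ≤ h i := by
      clear hij
      induction hji with
      | single hr =>
        rcases hr with hr | hr
        · exact hmono.monotone hr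
        · exact (comp_perm_eq_of_sameCycle hτ hr).le
      | tail _ hr ih =>
        rcases hr with hr | hr
        · exact ih.trans (hmono.monotone hr)
        · exact ih.trans (comp_perm_eq_of_sameCycle hτ hr).le
    exact (hmono hij).not_ge this

end Transverse

/-! ### Counting cycles -/

section Cycles

variable {P : Type*} [Fintype P] [DecidableEq P]

/-- The cycles are the nontrivial cycle factors together with the fixed points. -/
theorem cyc_add_card_support (τ : Equiv.Perm P) :
    cyc τ + τ.support.card = Fintype.card P + τ.cycleFactorsFinset.card := by
  classical
  have hne : ∀ c : τ.cycleFactorsFinset, ∃ x, x ∈ c.1.support := fun c =>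
    Finset.nonempty_iff_ne_empty.2 fun h =>
      (Equiv.Perm.mem_cycleFactorsFinset_iff.1 c.2).1.ne_one (Equiv.Perm.support_eq_empty_iff.1 h)
  choose p hp using hne
  have hpc : ∀ c : τ.cycleFactorsFinset, τ.cycleOf (p c) = c.1 := fun c =>
    (Equiv.Perm.cycle_is_cycleOf (hp c) c.2).symm
  have hps : ∀ c : τ.cycleFactorsFinset, τ (p c) ≠ p c := fun c h => by
    have h1 := Equiv.Perm.mem_cycleFactorsFinset_support_le c.2 (hp c)
    exact (Equiv.Perm.mem_support.1 h1) h
  let F : τ.cycleFactorsFinset ⊕ {x // x ∈ τ.supportᶜ} →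
      Quotient (Equiv.Perm.SameCycle.setoid τ) :=
    Sum.elim (fun c => Quotient.mk _ (p c)) (fun x => Quotient.mk _ x.1)
  have hfix : ∀ x : {x // x ∈ τ.supportᶜ}, τ x.1 = x.1 := fun x => by
    simpa only [Finset.mem_compl, Equiv.Perm.notMem_support] using x.2
  have hF : Function.Bijective F := by
    constructor
    · rintro (c | x) (d | y) h
      · have h1 : τ.SameCycle (p c) (p d) := Quotient.exact h
        have := h1.cycleOf_eq
        rw [hpc, hpc] at this
        rw [Subtype.ext this]
      · have h1 : τ.SameCycle (p c) y := Quotient.exact h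
        exact absurd (h1.apply_eq_self_iff.2 (hfix y)) (hps c)
      · have h1 : τ.SameCycle x (p d) := Quotient.exact h
        exact absurd (h1.apply_eq_self_iff.1 (hfix x)) (hps d)
      · have h1 : τ.SameCycle x y := Quotient.exact h
        rw [Subtype.ext (h1.eq_of_left (hfix x))]
    · intro q
      induction q using Quotient.inductionOn with
      | h x =>
      by_cases hx : τ x = x
      · exact ⟨Sum.inr ⟨x, by simpa using hx⟩, rfl⟩
      · have hmem : τ.cycleOf x ∈ τ.cycleFactorsFinset :=
          Equiv.Perm.cycleOf_mem_cycleFactorsFinset_iff.2 (by simpa using hx)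
        refine ⟨Sum.inl ⟨_, hmem⟩, Quotient.sound ?_⟩
        have h1 := hp ⟨_, hmem⟩
        exact ((Equiv.Perm.mem_support_cycleOf_iff.1 h1).1).symm
  have h1 := Nat.card_eq_of_bijective F hF
  have h2 := τ.support.card_add_card_compl
  rw [Nat.card_eq_fintype_card, Fintype.card_sum, Fintype.card_coe, Fintype.card_coe] at h1
  rw [cyc]
  omega

/-- The sum in the exponent has the parity of the codimension of the fixed space, without truncated
subtraction. -/
theorem sign_eq_neg_one_pow_cyc (τ : Equiv.Perm P) :
    ((Equiv.Perm.sign τ : ℤˣ) : ℤ) = (-1) ^ (Fintype.card P + cyc τ) := by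
  have h := cyc_add_card_support τ
  have hc : τ.cycleType.card = τ.cycleFactorsFinset.card := by
    simp [Equiv.Perm.cycleType]
  rw [Equiv.Perm.sign_of_cycleType, Equiv.Perm.sum_cycleType, hc]
  push_cast
  have he : Even (Fintype.card P + cyc τ) ↔ Even (τ.support.card + τ.cycleFactorsFinset.card) := by
    rw [Nat.even_iff, Nat.even_iff]
    omega
  by_cases hh : Even (Fintype.card P + cyc τ)
  · rw [hh.neg_one_pow, (he.1 hh).neg_one_pow]
  · rw [(Nat.not_even_iff_odd.1 hh).neg_one_pow,
      (Nat.not_even_iff_odd.1 (fun h => hh (he.2 h))).neg_one_pow]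

end Cycles

/-! ### Fixed spaces of permutations and the Möbius function of the braid arrangement -/

section Braid

variable {P : Type*}

/-- The space of vectors invariant under a permutation of the coordinates. -/
def fixedSpace (τ : Equiv.Perm P) : Submodule ℝ (P → ℝ) where
  carrier := {x | ∀ i, x (τ i) = x i}
  add_mem' hx hy i := by simp [hx i, hy i]
  zero_mem' _ := rfl
  smul_mem' c x hx i := by simp [hx i]

theorem mem_fixedSpace {τ : Equiv.Perm P} {x : P → ℝ} :
    x ∈ fixedSpace τ ↔ ∀ i, x (τ i) = x i := Iff.rfl

/-- The fixed space of a permutation, as an element of the intersection poset. -/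
def fixedFlat (τ : Equiv.Perm P) : IntersectionPoset (braidArrangement P) :=
  ⟨OrderDual.toDual (fixedSpace τ), {H | ∃ i, τ i ≠ i ∧ H = braidHyperplane (τ i) i}, by
    rintro H ⟨i, hi, rfl⟩
    exact ⟨_, _, hi, rfl⟩, by
    ext x
    simp only [OrderDual.ofDual_toDual, mem_fixedSpace, Submodule.mem_sInf, Set.mem_ofPred_eq]
    constructor
    · rintro hx H ⟨i, -, rfl⟩
      exact hx i
    · intro hx i
      by_cases hi : τ i = i
      · rw [hi]
      · exact hx _ ⟨i, hi, rfl⟩⟩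

@[simp]
theorem space_fixedFlat (τ : Equiv.Perm P) : (fixedFlat τ).space = fixedSpace τ := rfl

/-- Invariant vectors are the functions on the set of cycles. -/
theorem finrank_fixedSpace [Finite P] (τ : Equiv.Perm P) :
    Module.finrank ℝ (fixedSpace τ) = cyc τ := by
  classical
  have := Fintype.ofFinite P
  have : Fintype (Quotient (Equiv.Perm.SameCycle.setoid τ)) := Fintype.ofFinite _
  let e : (Quotient (Equiv.Perm.SameCycle.setoid τ) → ℝ) ≃ₗ[ℝ] fixedSpace τ :=
    { toFun := fun f => ⟨fun x => f (Quotient.mk _ x), fun i => by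
        change f _ = f _
        congr 1
        exact Quotient.sound ⟨-1, by simp⟩⟩
      map_add' := fun _ _ => rfl
      map_smul' := fun _ _ => rfl
      invFun := fun x q => Quotient.liftOn q x.1 fun a b hab =>
        comp_perm_eq_of_sameCycle x.2 hab
      left_inv := fun f => by
        ext q
        induction q using Quotient.inductionOn
        rfl
      right_inv := fun _ => rfl }
  rw [← e.finrank_eq, Module.finrank_fintype_fun_eq_card, cyc, Nat.card_eq_fintype_card]

theorem codim_fixedFlat [Fintype P] (τ : Equiv.Perm P) :
    (fixedFlat τ).codim = Fintype.card P - cyc τ := by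
  rw [IntersectionPoset.codim, space_fixedFlat, finrank_fixedSpace,
    Module.finrank_fintype_fun_eq_card]

theorem space_le_space_iff {X Y : IntersectionPoset (braidArrangement P)} :
    X ≤ Y ↔ Y.space ≤ X.space := Iff.rfl

theorem IntersectionPoset.ambient_le (X : IntersectionPoset (braidArrangement P)) :
    IntersectionPoset.ambient ≤ X :=
  space_le_space_iff.2 le_top

variable [Fintype P] [DecidableEq P]

open scoped Classical in
/-- The signs of the permutations that fix a given flat pointwise cancel unless the flat is the
whole space. -/
theorem sum_sign_fixedFlat_le (X : IntersectionPoset (braidArrangement P)) :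
    (∑ τ : Equiv.Perm P with fixedFlat τ ≤ X, ((Equiv.Perm.sign τ : ℤˣ) : ℤ)) =
      if IntersectionPoset.ambient = X then 1 else 0 := by
  split_ifs with hX
  · subst hX
    rw [Finset.sum_eq_single (1 : Equiv.Perm P)]
    · simp
    · intro τ hτ hne
      exfalso
      apply hne
      rw [Finset.mem_filter, space_le_space_iff] at hτ
      ext i
      by_contra hi
      -- The indicator vector of `i` is invariant only if `τ` fixes `i`.
      have := hτ.2 (show (Pi.single i 1 : P → ℝ) ∈ _ from Submodule.mem_top) i
      simp [show ¬ (τ i = i) from hi] at this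
    · intro h
      exfalso
      apply h
      rw [Finset.mem_filter]
      exact ⟨Finset.mem_univ _, fun x _ i => rfl⟩
  · obtain ⟨B, hB, hXB⟩ := X.2
    have hBne : B.Nonempty := by
      rw [Set.nonempty_iff_ne_empty]
      rintro rfl
      apply hX
      apply Subtype.ext
      rw [sInf_empty] at hXB
      exact hXB.symm
    obtain ⟨H, hH⟩ := hBne
    obtain ⟨i, j, hij, rfl⟩ := hB hH
    have hswap : ∀ x ∈ X.space, ∀ k, x (Equiv.swap i j k) = x k := by
      intro x hx k
      have hx' : x i = x j := by
        change x ∈ OrderDual.ofDual X.1 at hx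
        rw [hXB, Submodule.mem_sInf] at hx
        exact hx _ hH
      by_cases h1 : k = i
      · subst h1; rw [Equiv.swap_apply_left, hx']
      by_cases h2 : k = j
      · subst h2; rw [Equiv.swap_apply_right, hx']
      rw [Equiv.swap_apply_of_ne_of_ne h1 h2]
    -- The flat lies in `x i = x j`, so multiplying by this transposition preserves the index set
    -- and reverses the sign.
    refine Finset.sum_involution (fun τ _ => Equiv.swap i j * τ) ?_ ?_ ?_ ?_
    · intro τ _
      simp [Equiv.Perm.sign_mul, Equiv.Perm.sign_swap hij]
    · intro τ _ _ h
      have : Equiv.swap i j = 1 := by simpa using h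
      exact hij (Equiv.swap_eq_one_iff.1 this)
    · intro τ hτ
      rw [Finset.mem_filter, space_le_space_iff] at hτ ⊢
      refine ⟨Finset.mem_univ _, fun x hx k => ?_⟩
      rw [Equiv.Perm.mul_apply, hswap x hx]
      exact hτ.2 hx k
    · intro τ _
      simp [← mul_assoc]

open scoped Classical in
-- Both sides have the same sum over every interval from the ambient space to `X`; by induction the
-- terms below `X` agree, which leaves the top ones.
theorem mu_ambient_eq_sum_sign (X : IntersectionPoset (braidArrangement P)) :
    IncidenceAlgebra.mu ℤ IntersectionPoset.ambient X =
      ∑ τ : Equiv.Perm P with fixedFlat τ = X, ((Equiv.Perm.sign τ : ℤˣ) : ℤ) := by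
  induction X using WellFoundedLT.induction with
  | ind X ih =>
  have h1 := IncidenceAlgebra.sum_Icc_mu_right (𝕜 := ℤ) IntersectionPoset.ambient X
  have h2 := sum_sign_fixedFlat_le X
  have h3 : (∑ τ : Equiv.Perm P with fixedFlat τ ≤ X, ((Equiv.Perm.sign τ : ℤˣ) : ℤ)) =
      ∑ Y ∈ Finset.Icc IntersectionPoset.ambient X,
        ∑ τ : Equiv.Perm P with fixedFlat τ = Y, ((Equiv.Perm.sign τ : ℤˣ) : ℤ) := by
    rw [← Finset.sum_fiberwise_of_maps_to (g := fixedFlat)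
      (t := Finset.Icc IntersectionPoset.ambient X)]
    · refine Finset.sum_congr rfl fun Y hY => Finset.sum_congr ?_ fun _ _ => rfl
      ext τ
      simp only [Finset.mem_filter, Finset.mem_univ, true_and, and_iff_right_iff_imp]
      rintro rfl
      exact (Finset.mem_Icc.1 hY).2
    · intro τ hτ
      exact Finset.mem_Icc.2 ⟨IntersectionPoset.ambient_le _, (Finset.mem_filter.1 hτ).2⟩
  have hle := IntersectionPoset.ambient_le X
  rw [← Finset.Ico_insert_right hle, Finset.sum_insert Finset.right_notMem_Ico] at h1 h3
  rw [Finset.sum_congr rfl fun Y hY => ih Y (Finset.mem_Ico.1 hY).2] at h1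
  rw [h3] at h2
  rw [← h2] at h1
  exact add_right_cancel h1

open scoped Classical in
-- No cancellation occurs: permutations with the same fixed space have equally many cycles, hence
-- the same sign.
theorem abs_mu_ambient (X : IntersectionPoset (braidArrangement P)) :
    |IncidenceAlgebra.mu ℤ IntersectionPoset.ambient X| =
      (Finset.univ.filter fun τ : Equiv.Perm P => fixedFlat τ = X).card := by
  rw [mu_ambient_eq_sum_sign, Finset.sum_congr rfl (g := fun _ =>
    (-1) ^ (Fintype.card P + Module.finrank ℝ X.space))]
  · rw [Finset.sum_const, abs_nsmul, abs_pow, abs_neg, abs_one, one_pow, nsmul_eq_mul, mul_one]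
  · intro τ hτ
    rw [Finset.mem_filter] at hτ
    rw [← hτ.2, space_fixedFlat, finrank_fixedSpace, sign_eq_neg_one_pow_cyc]

end Braid

/-! ### The Poincaré polynomial as a cycle enumerator -/

section Poincare

variable {P : Type*} [PartialOrder P]

/-- A point of the intersection is precisely an invariant strictly increasing function. -/
theorem fixedSpace_inter_posetCone_nonempty_iff [Finite P] (τ : Equiv.Perm P) :
    (((fixedFlat τ).space : Set (P → ℝ)) ∩ posetCone P).Nonempty ↔
      IsTransversePartition (Equiv.Perm.SameCycle.setoid τ) := by
  rw [isTransversePartition_iff]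
  exact Iff.rfl

/-- The Poincaré polynomial of a poset enumerates its transverse permutations by cycles. -/
theorem poin_eq_sum_transversePerm [Fintype P] [Fintype (TransversePerm P)] :
    poin P = ∑ τ : TransversePerm P, (X : ℤ[X]) ^ (Fintype.card P - cyc τ.1) := by
  classical
  have hw : ∀ k, whitney (braidArrangement P) (posetCone P) k =
      ∑ τ : Equiv.Perm P with IsTransversePartition (Equiv.Perm.SameCycle.setoid τ),
        if Fintype.card P - cyc τ = k then (1 : ℤ) else 0 := by
    intro k
    rw [whitney, Finset.sum_congr rfl fun X _ => abs_mu_ambient X, ← Finset.sum_filter,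
      Finset.filter_filter, Finset.sum_const, nsmul_eq_mul, mul_one, ← Nat.cast_sum]
    congr 1
    rw [Finset.card_eq_sum_card_fiberwise (f := fixedFlat)
      (t := Finset.univ.filter fun X : IntersectionPoset (braidArrangement P) =>
        ((X.space : Set (P → ℝ)) ∩ posetCone P).Nonempty ∧ X.codim = k)]
    · refine Finset.sum_congr rfl fun X hX => ?_
      congr 1
      ext τ
      simp only [Finset.mem_filter, Finset.mem_univ, true_and] at hX ⊢
      refine ⟨?_, fun h => h.2⟩
      rintro rfl
      rw [fixedSpace_inter_posetCone_nonempty_iff, codim_fixedFlat] at hX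
      exact ⟨hX, rfl⟩
    · intro τ hτ
      simp only [Finset.coe_filter, Finset.mem_univ, true_and, Set.mem_ofPred_eq] at hτ ⊢
      rw [fixedSpace_inter_posetCone_nonempty_iff, codim_fixedFlat]
      exact hτ
  rw [poin, poincareCone, Module.finrank_fintype_fun_eq_card]
  simp_rw [hw, map_sum, Finset.sum_mul]
  rw [Finset.sum_comm]
  have hsub : (∑ τ : TransversePerm P, (X : ℤ[X]) ^ (Fintype.card P - cyc τ.1)) =
      ∑ τ : Equiv.Perm P with IsTransversePartition (Equiv.Perm.SameCycle.setoid τ),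
        (X : ℤ[X]) ^ (Fintype.card P - cyc τ) := by
    refine Finset.sum_nbij Subtype.val (fun τ _ => ?_) (fun τ _ τ' _ h => Subtype.ext h)
      (fun τ hτ => ?_) fun _ _ => rfl
    · exact Finset.mem_filter.2 ⟨Finset.mem_univ _, τ.2⟩
    · exact ⟨⟨τ, (Finset.mem_filter.1 hτ).2⟩, Finset.mem_coe.2 (Finset.mem_univ _), rfl⟩
  rw [hsub]
  refine Finset.sum_congr rfl fun τ _ => ?_
  rw [Finset.sum_eq_single (Fintype.card P - cyc τ)]
  · simp
  · intro k _ hk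
    simp [hk.symm]
  · intro h
    exact absurd (Finset.mem_range.2 (Nat.lt_succ_of_le (Nat.sub_le _ _))) h

end Poincare

/-! ### Rows of a multiset permutation -/

section Rows

variable {ℓ : ℕ}

theorem map_fst_twoLine (w : List (Fin ℓ)) :
    (twoLine w).map Prod.fst = w.insertionSort (· ≤ ·) :=
  List.map_fst_zip (by simp)

theorem map_snd_twoLine (w : List (Fin ℓ)) : (twoLine w).map Prod.snd = w :=
  List.map_snd_zip (by simp)

theorem length_twoLine (w : List (Fin ℓ)) : (twoLine w).length = w.length := by
  simp [twoLine]

theorem pairwise_fst_twoLine (w : List (Fin ℓ)) :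
    (twoLine w).Pairwise (fun c d => c.1 ≤ d.1) := by
  rw [← List.pairwise_map (f := Prod.fst) (R := (· ≤ ·)), map_fst_twoLine]
  exact List.pairwise_insertionSort (· ≤ ·) w

theorem map_fst_twoLine_perm (w : List (Fin ℓ)) :
    ((twoLine w).map Prod.fst).Perm ((twoLine w).map Prod.snd) := by
  rw [map_fst_twoLine, map_snd_twoLine]
  exact List.perm_insertionSort _ _

/-- A list of columns is a two-line notation if its top line is weakly increasing and is
a rearrangement of its bottom line. -/
theorem twoLine_map_snd {l : List (Fin ℓ × Fin ℓ)} (hl : l.Pairwise (fun c d => c.1 ≤ d.1))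
    (hp : (l.map Prod.fst).Perm (l.map Prod.snd)) : twoLine (l.map Prod.snd) = l := by
  have h : (l.map Prod.snd).insertionSort (· ≤ ·) = l.map Prod.fst :=
    List.Perm.eq_of_pairwise' (r := (· ≤ ·)) (List.pairwise_insertionSort _ _)
      (List.pairwise_map.2 hl) ((List.perm_insertionSort _ _).trans hp.symm)
  rw [twoLine, h]
  exact (List.zip_of_prod rfl rfl).symm

/-- The juxtaposed tops are a rearrangement of the juxtaposed bottoms, so the sorted columns already
form a two-line notation. -/
theorem twoLine_intercalation (u v : List (Fin ℓ)) :
    twoLine (intercalation u v) =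
      (twoLine u ++ twoLine v).insertionSort (fun c d => c.1 ≤ d.1) := by
  have : Std.Total (fun c d : Fin ℓ × Fin ℓ => c.1 ≤ d.1) := ⟨fun c d => le_total c.1 d.1⟩
  have : IsTrans (Fin ℓ × Fin ℓ) (fun c d => c.1 ≤ d.1) := ⟨fun _ _ _ => le_trans⟩
  refine twoLine_map_snd (List.pairwise_insertionSort _ _) ?_
  have h := List.perm_insertionSort (fun c d : Fin ℓ × Fin ℓ => c.1 ≤ d.1)
    (twoLine u ++ twoLine v)
  refine (h.map _).trans (List.Perm.trans ?_ (h.map _).symm)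
  rw [List.map_append, List.map_append]
  exact (map_fst_twoLine_perm u).append (map_fst_twoLine_perm v)

theorem length_intercalation (u v : List (Fin ℓ)) :
    (intercalation u v).length = u.length + v.length := by
  simp [intercalation, length_twoLine]

/-- A column only moves past columns with strictly smaller top, and the filter never keeps both. -/
theorem filter_orderedInsert_fst {α β : Type*} [LinearOrder α] (i : α) (c : α × β)
    (l : List (α × β)) :
    (l.orderedInsert (fun c d => c.1 ≤ d.1) c).filter (fun d => d.1 = i) =
      (c :: l).filter (fun d => d.1 = i) := by
  induction l with
  | nil => rfl
  | cons d l ih =>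
    rw [List.orderedInsert_cons]
    split_ifs with h
    · rfl
    · rw [List.filter_cons, ih]
      by_cases hc : c.1 = i
      · have hd : d.1 ≠ i := by rintro rfl; exact h hc.le
        simp [List.filter_cons, hd]
      · simp [List.filter_cons, hc]

/-- Sorting columns stably by their top entries keeps the order of columns with the same top. -/
theorem filter_insertionSort_fst {α β : Type*} [LinearOrder α] (i : α) (l : List (α × β)) :
    (l.insertionSort (fun c d => c.1 ≤ d.1)).filter (fun d => d.1 = i) =
      l.filter (fun d => d.1 = i) := by
  induction l with
  | nil => rfl
  | cons c l ih =>
    rw [List.insertionSort_cons, filter_orderedInsert_fst, List.filter_cons, List.filter_cons, ih]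

/-- A list of columns sorted by their top entries is determined by the columns with given tops. -/
theorem eq_of_filter_fst_eq {α β : Type*} [LinearOrder α] {l l' : List (α × β)}
    (hl : l.Pairwise (fun c d => c.1 ≤ d.1)) (hl' : l'.Pairwise (fun c d => c.1 ≤ d.1))
    (h : ∀ i, l.filter (fun d => d.1 = i) = l'.filter (fun d => d.1 = i)) : l = l' := by
  induction l generalizing l' with
  | nil =>
    cases l' with
    | nil => rfl
    | cons d l' => simpa using h d.1
  | cons c l ih =>
    cases l' with
    | nil => simpa using h c.1
    | cons d l' =>
      rw [List.pairwise_cons] at hl hl'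
      have h1 : d ∈ c :: l := by
        have : d ∈ (c :: l).filter (fun e => e.1 = d.1) := by rw [h]; simp
        exact (List.mem_filter.1 this).1
      have h2 : c ∈ d :: l' := by
        have : c ∈ (d :: l').filter (fun e => e.1 = c.1) := by rw [← h]; simp
        exact (List.mem_filter.1 this).1
      have hcd : c.1 = d.1 := by
        apply le_antisymm
        · rcases List.mem_cons.1 h1 with rfl | h1
          · exact le_rfl
          · exact hl.1 _ h1
        · rcases List.mem_cons.1 h2 with rfl | h2
          · exact le_rfl
          · exact hl'.1 _ h2
      have hc := h c.1
      rw [List.filter_cons_of_pos (by simp), List.filter_cons_of_pos (by simp [hcd]),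
        List.cons.injEq] at hc
      obtain ⟨rfl, hc⟩ := hc
      rw [ih hl.2 hl'.2 fun i => ?_]
      have hi := h i
      by_cases hci : c.1 = i
      · rw [← hci]; exact hc
      · rwa [List.filter_cons_of_neg (by simpa using hci),
          List.filter_cons_of_neg (by simpa using hci)] at hi

/-- The bottom entries of the columns with top entry `i`, from left to right. -/
def row (w : List (Fin ℓ)) (i : Fin ℓ) : List (Fin ℓ) :=
  ((twoLine w).filter (fun c => c.1 = i)).map Prod.snd

theorem map_snd_filter_fst_injective {i : Fin ℓ} {l l' : List (Fin ℓ × Fin ℓ)}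
    (h : (l.filter (fun c => c.1 = i)).map Prod.snd = (l'.filter (fun c => c.1 = i)).map Prod.snd) :
    l.filter (fun c => c.1 = i) = l'.filter (fun c => c.1 = i) := by
  have key : ∀ l : List (Fin ℓ × Fin ℓ), l.filter (fun c => c.1 = i) =
      ((l.filter (fun c => c.1 = i)).map Prod.snd).map (fun j => (i, j)) := by
    intro l
    rw [List.map_map]
    refine (List.map_id _).symm.trans (List.map_congr_left fun c hc => ?_)
    have hci : c.1 = i := by simpa using (List.mem_filter.1 hc).2
    exact Prod.ext hci rfl
  rw [key l, key l', h]

theorem row_injective {u v : List (Fin ℓ)} (h : ∀ i, row u i = row v i) : u = v := by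
  have : twoLine u = twoLine v :=
    eq_of_filter_fst_eq (pairwise_fst_twoLine u) (pairwise_fst_twoLine v)
      fun i => map_snd_filter_fst_injective (h i)
  rw [← map_snd_twoLine u, this, map_snd_twoLine]

theorem row_intercalation (u v : List (Fin ℓ)) (i : Fin ℓ) :
    row (intercalation u v) i = row u i ++ row v i := by
  rw [row, twoLine_intercalation, filter_insertionSort_fst, List.filter_append, List.map_append]
  rfl

theorem row_nil (i : Fin ℓ) : row [] i = [] := rfl

theorem row_foldr_intercalation (L : List (List (Fin ℓ))) (i : Fin ℓ) :
    row (L.foldr intercalation []) i = L.flatMap (fun c => row c i) := by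
  induction L with
  | nil => rfl
  | cons c L ih => rw [List.foldr_cons, row_intercalation, ih, List.flatMap_cons]

theorem length_row (w : List (Fin ℓ)) (i : Fin ℓ) : (row w i).length = w.count i := by
  rw [row, List.length_map, ← List.countP_eq_length_filter,
    ← (List.perm_insertionSort (· ≤ ·) w).count_eq, ← map_fst_twoLine, List.count, List.countP_map]
  congr 1

theorem sum_count_filter_fst (l : List (Fin ℓ × Fin ℓ)) (i : Fin ℓ) :
    ∑ j, ((l.filter (fun c => c.1 = j)).map Prod.snd).count i = (l.map Prod.snd).count i := by
  induction l with
  | nil => simp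
  | cons c l ih =>
    rw [List.map_cons, List.count_cons, ← ih, Finset.sum_congr rfl (g := fun j =>
      ((l.filter (fun c => c.1 = j)).map Prod.snd).count i +
        if c.1 = j then (if c.2 == i then 1 else 0) else 0), Finset.sum_add_distrib,
      Finset.sum_ite_eq]
    · simp
    · intro j _
      by_cases h : c.1 = j
      · rw [List.filter_cons_of_pos (by simpa using h), List.map_cons, List.count_cons, if_pos h]
      · rw [List.filter_cons_of_neg (by simpa using h), if_neg h, add_zero]

/-- With `length_row` this is the balance condition on rows; `exists_row_eq` is the converse. -/
theorem sum_count_row (w : List (Fin ℓ)) (i : Fin ℓ) :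
    ∑ j, (row w j).count i = w.count i := by
  simp only [row, sum_count_filter_fst, map_snd_twoLine]

/-- Every balanced family of words is the family of rows of a multiset permutation. -/
theorem exists_row_eq (f : Fin ℓ → List (Fin ℓ))
    (hf : ∀ i, ∑ j, (f j).count i = (f i).length) : ∃ w, ∀ i, row w i = f i := by
  let cols : List (Fin ℓ × Fin ℓ) :=
    (List.finRange ℓ).flatMap fun j => (f j).map fun k => (j, k)
  have hfilter : ∀ i, cols.filter (fun c => c.1 = i) = (f i).map fun k => (i, k) := by
    intro i
    have h1 : ∀ L : List (Fin ℓ), L.Nodup →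
        (L.flatMap fun j => (f j).map fun k => (j, k)).filter (fun c => c.1 = i) =
          if i ∈ L then (f i).map fun k => (i, k) else [] := by
      intro L hL
      induction L with
      | nil => simp
      | cons j L ih =>
        rw [List.nodup_cons] at hL
        rw [List.flatMap_cons, List.filter_append, ih hL.2]
        by_cases hj : j = i
        · subst hj
          rw [if_neg hL.1, if_pos List.mem_cons_self, List.append_nil, List.filter_eq_self]
          simp
        · have : ((f j).map fun k => (j, k)).filter (fun c => c.1 = i) = [] := by
            rw [List.filter_eq_nil_iff]
            simp [hj]
          rw [this, List.nil_append]
          simp [Ne.symm hj]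
    rw [h1 _ (List.nodup_finRange ℓ), if_pos (List.mem_finRange i)]
  have hpair : cols.Pairwise (fun c d => c.1 ≤ d.1) := by
    rw [List.pairwise_flatMap]
    refine ⟨fun j _ => List.pairwise_map.2 (List.pairwise_of_forall fun _ _ => le_rfl), ?_⟩
    refine (List.pairwise_lt_finRange ℓ).imp fun {j k} hjk => ?_
    intro c hc d hd
    obtain ⟨_, -, rfl⟩ := List.mem_map.1 hc
    obtain ⟨_, -, rfl⟩ := List.mem_map.1 hd
    exact hjk.le
  have hperm : (cols.map Prod.fst).Perm (cols.map Prod.snd) := by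
    rw [List.perm_iff_count]
    intro i
    rw [← sum_count_filter_fst]
    have h2 : (cols.map Prod.fst).count i = (cols.filter (fun c => c.1 = i)).length := by
      rw [List.count, List.countP_map, List.countP_eq_length_filter]
      congr 2
    rw [h2, hfilter, List.length_map, ← hf]
    refine Finset.sum_congr rfl fun j _ => ?_
    rw [hfilter, List.map_map]
    congr 1
    exact (List.map_id _).symm
  refine ⟨cols.map Prod.snd, fun i => ?_⟩
  rw [row, twoLine_map_snd hpair hperm, hfilter, List.map_map]
  exact List.map_id _

end Rows

/-! ### Prime cycles and decompositions -/

section Prime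

variable {ℓ : ℕ}

theorem foldr_intercalation_append (L L' : List (List (Fin ℓ))) :
    (L ++ L').foldr intercalation [] =
      intercalation (L.foldr intercalation []) (L'.foldr intercalation []) := by
  refine row_injective fun i => ?_
  rw [row_intercalation, row_foldr_intercalation, row_foldr_intercalation, row_foldr_intercalation,
    List.flatMap_append]

theorem exists_isPrimeDecomposition (w : List (Fin ℓ)) : ∃ L, IsPrimeDecomposition w L := by
  induction hn : w.length using Nat.strong_induction_on generalizing w with
  | _ n ih =>
  by_cases hw : w = []
  · exact ⟨[], by simp, by rw [hw]; rfl⟩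
  by_cases hp : IsPrimeCycle w
  · refine ⟨[w], by simpa using hp, row_injective fun i => ?_⟩
    rw [row_foldr_intercalation]
    simp
  · have : ∃ u v : List (Fin ℓ), w = intercalation u v ∧ u ≠ [] ∧ v ≠ [] := by
      by_contra! hcon
      refine hp ⟨hw, fun u v huv => ?_⟩
      by_cases hu : u = []
      · exact Or.inl hu
      · exact Or.inr (hcon u v huv hu)
    obtain ⟨u, v, rfl, hu, hv⟩ := this
    rw [length_intercalation] at hn
    have hu' := List.length_pos_iff.2 hu
    have hv' := List.length_pos_iff.2 hv
    obtain ⟨L, hL, hLu⟩ := ih u.length (by omega) u rfl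
    obtain ⟨L', hL', hLv⟩ := ih v.length (by omega) v rfl
    refine ⟨L ++ L', fun c hc => ?_, ?_⟩
    · rcases List.mem_append.1 hc with h | h
      · exact hL c h
      · exact hL' c h
    · rw [foldr_intercalation_append, ← hLu, ← hLv]

/-- `S` is a minimal nonempty set of letters closed under `g`, that is, a cycle of `g`. -/
structure IsMinimalClosed {α : Type*} (g : α → α) (S : Finset α) : Prop where
  nonempty : S.Nonempty
  map_mem : ∀ i ∈ S, g i ∈ S
  eq_of_subset : ∀ T ⊆ S, T.Nonempty → (∀ i ∈ T, g i ∈ T) → T = S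

/-- The image of `S` is again nonempty and closed, so it is `S` by minimality; a surjection of a
finite set onto itself is injective. -/
theorem IsMinimalClosed.injOn {α : Type*} [DecidableEq α] {g : α → α} {S : Finset α}
    (h : IsMinimalClosed g S) : Set.InjOn g S := by
  have himg : S.image g = S := by
    refine h.eq_of_subset _ ?_ (h.nonempty.image g) ?_
    · exact Finset.image_subset_iff.2 h.map_mem
    · intro i hi
      obtain ⟨j, hj, rfl⟩ := Finset.mem_image.1 hi
      exact Finset.mem_image_of_mem g (h.map_mem _ hj)
  exact Finset.card_image_iff.1 (by rw [himg])

theorem exists_isMinimalClosed {α : Type*} {g : α → α} {A : Finset α} (hA : A.Nonempty)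
    (hg : ∀ i ∈ A, g i ∈ A) : ∃ S ⊆ A, IsMinimalClosed g S := by
  induction hn : A.card using Nat.strong_induction_on generalizing A with
  | _ n ih =>
  by_cases h : IsMinimalClosed g A
  · exact ⟨A, subset_rfl, h⟩
  · have : ∃ T ⊆ A, T.Nonempty ∧ (∀ i ∈ T, g i ∈ T) ∧ T ≠ A := by
      by_contra! hcon
      exact h ⟨hA, hg, hcon⟩
    obtain ⟨T, hTA, hT, hgT, hne⟩ := this
    obtain ⟨S, hST, hS⟩ := ih T.card (hn ▸ Finset.card_lt_card (hTA.ssubset_of_ne hne)) hT hgT rfl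
    exact ⟨S, hST.trans hTA, hS⟩

/-- In a prime cycle every letter occurs at most once, and the successor map permutes the
letters cyclically. -/
theorem IsPrimeCycle.exists_isMinimalClosed {c : List (Fin ℓ)} (hc : IsPrimeCycle c) :
    ∃ (g : Fin ℓ → Fin ℓ) (S : Finset (Fin ℓ)), IsMinimalClosed g S ∧
      ∀ i, row c i = if i ∈ S then [g i] else [] := by
  -- The successor of a letter is the head of its row; the default value is only met on empty rows,
  -- outside `A`.
  let g : Fin ℓ → Fin ℓ := fun i => (row c i).headD i
  let A : Finset (Fin ℓ) := Finset.univ.filter fun i => row c i ≠ []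
  have hcons : ∀ i ∈ A, row c i = g i :: (row c i).tail := by
    intro i hi
    have hne : row c i ≠ [] := (Finset.mem_filter.1 hi).2
    simp only [g]
    cases h : row c i with
    | nil => exact absurd h hne
    | cons a l => rfl
  have hgA : ∀ i ∈ A, g i ∈ A := by
    intro i hi
    refine Finset.mem_filter.2 ⟨Finset.mem_univ _, ?_⟩
    -- The letter `g i` occurs in row `i`, so by balance its own row is nonempty.
    rw [← List.length_pos_iff, length_row, ← sum_count_row]
    refine Finset.sum_pos' (fun _ _ => Nat.zero_le _) ⟨i, Finset.mem_univ _, ?_⟩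
    rw [List.count_pos_iff, hcons i hi]
    exact List.mem_cons_self
  have hA : A.Nonempty := by
    obtain ⟨i, hi⟩ := List.exists_mem_of_ne_nil c hc.1
    refine ⟨i, Finset.mem_filter.2 ⟨Finset.mem_univ _, ?_⟩⟩
    rw [← List.length_pos_iff, length_row]
    exact List.count_pos_iff.2 hi
  obtain ⟨S, hSA, hS⟩ := _root_.exists_isMinimalClosed hA hgA
  refine ⟨g, S, hS, ?_⟩
  -- Split off the heads of the rows in `S`. Heads and remainders are both balanced, so `c` factors;
  -- the head factor is nonempty, and primality makes the remainder empty.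
  let f : Fin ℓ → List (Fin ℓ) := fun i => if i ∈ S then [g i] else []
  let f' : Fin ℓ → List (Fin ℓ) := fun i => if i ∈ S then (row c i).tail else row c i
  have happ : ∀ i, row c i = f i ++ f' i := by
    intro i
    by_cases hi : i ∈ S
    · simp only [f, f', if_pos hi]
      exact hcons i (hSA hi)
    · simp [f, f', hi]
  have hfbal : ∀ i, ∑ j, (f j).count i = (f i).length := by
    have himg : S.image g = S :=
      Finset.eq_of_subset_of_card_le (Finset.image_subset_iff.2 hS.map_mem)
        (Finset.card_image_of_injOn hS.injOn).ge
    intro i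
    by_cases hi : i ∈ S
    · obtain ⟨j, hj, hji⟩ := Finset.mem_image.1 (himg.symm ▸ hi)
      rw [Finset.sum_eq_single j]
      · simp [f, hi, hj, hji]
      · intro k _ hk
        by_cases hkS : k ∈ S
        · have : g k ≠ i := fun h => hk (hS.injOn hkS hj (h.trans hji.symm))
          simp [f, hkS, this]
        · simp [f, hkS]
      · simp
    · simp only [f, if_neg hi, List.length_nil]
      refine Finset.sum_eq_zero fun j _ => ?_
      split_ifs with hj
      · have : g j ≠ i := fun h => hi (h ▸ hS.map_mem j hj)
        simp [this]
      · simp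
  have hf'bal : ∀ i, ∑ j, (f' j).count i = (f' i).length := by
    intro i
    have h1 : ∑ j, (row c j).count i = (row c i).length := by rw [sum_count_row, length_row]
    simp only [happ, List.count_append, List.length_append, Finset.sum_add_distrib, hfbal] at h1
    omega
  obtain ⟨u, hu⟩ := exists_row_eq f hfbal
  obtain ⟨v, hv⟩ := exists_row_eq f' hf'bal
  have huv : c = intercalation u v := row_injective fun i => by
    rw [row_intercalation, hu, hv, happ]
  rcases hc.2 u v huv with rfl | rfl
  · obtain ⟨i, hi⟩ := hS.nonempty
    have := hu i
    simp [f, hi, row_nil] at this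
  · intro i
    rw [happ, ← hv i, row_nil, List.append_nil]

end Prime

/-! ### Rigidity of transverse permutations -/

/-- Two permutations that leave strictly increasing functions invariant are equal if their values
are everywhere comparable. -/
theorem perm_eq_of_strictMono_invariant {P : Type*} [Finite P] [PartialOrder P]
    {τ τ' : Equiv.Perm P} {h h' : P → ℝ} (hτ : ∀ x, h (τ x) = h x) (hh : StrictMono h)
    (hτ' : ∀ x, h' (τ' x) = h' x) (hh' : StrictMono h')
    (hcomp : ∀ x, τ x ≤ τ' x ∨ τ' x ≤ τ x) : τ = τ' := by
  classical
  have := Fintype.ofFinite P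
  have key : ∀ (N : ℕ) (U : Finset P), U.card = N → (∀ x ∈ U, τ x ∈ U) → (∀ x ∈ U, τ' x ∈ U) →
      ∀ x ∈ U, τ x = τ' x := by
    intro N
    induction N using Nat.strong_induction_on with
    | _ N ih =>
    intro U hN hU hU' x hx
    -- On the minimal level of `h + h'` the permutations agree: if `τ y < τ' y`, then `h'` is
    -- smaller at `τ y` than at `y` while `h` is unchanged, contradicting minimality. The other case
    -- is symmetric.
    obtain ⟨z, hz, hmin⟩ := U.exists_min_image (fun y => h y + h' y) ⟨x, hx⟩
    let T := U.filter fun y => h y + h' y = h z + h' z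
    have hT : ∀ y ∈ T, τ y = τ' y ∧ τ y ∈ T := by
      intro y hy
      obtain ⟨hyU, hyz⟩ := Finset.mem_filter.1 hy
      have heq : τ y = τ' y := by
        rcases hcomp y with hc | hc
        · by_contra hne
          have h1 := hh' (lt_of_le_of_ne hc hne)
          have h2 := hmin _ (hU y hyU)
          simp only [hτ, hτ'] at h1 h2
          linarith
        · by_contra hne
          have h1 := hh (lt_of_le_of_ne hc (Ne.symm hne))
          have h2 := hmin _ (hU' y hyU)
          simp only [hτ, hτ'] at h1 h2
          linarith
      refine ⟨heq, Finset.mem_filter.2 ⟨hU y hyU, ?_⟩⟩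
      rw [← hyz, hτ, heq, hτ']
    -- By finiteness the level set is mapped onto itself, so its complement in `U` is stable and the
    -- induction continues there.
    have himg : T.image τ = T :=
      Finset.eq_of_subset_of_card_le (Finset.image_subset_iff.2 fun y hy => (hT y hy).2)
        (Finset.card_image_of_injective _ τ.injective).ge
    have hback : ∀ y, τ y ∈ T → y ∈ T := by
      intro y hy
      rw [← himg] at hy
      obtain ⟨t, ht, hty⟩ := Finset.mem_image.1 hy
      rwa [← τ.injective hty]
    have hback' : ∀ y, τ' y ∈ T → y ∈ T := by
      intro y hy
      rw [← himg] at hy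
      obtain ⟨t, ht, hty⟩ := Finset.mem_image.1 hy
      rw [(hT t ht).1] at hty
      rwa [← τ'.injective hty]
    by_cases hxT : x ∈ T
    · exact (hT x hxT).1
    · have hlt : (U \ T).card < N := by
        rw [← hN]
        refine Finset.card_lt_card (Finset.sdiff_subset.ssubset_of_ne fun hEq => ?_)
        have : z ∈ U \ T := hEq.symm ▸ hz
        exact (Finset.mem_sdiff.1 this).2 (Finset.mem_filter.2 ⟨hz, rfl⟩)
      refine ih _ hlt (U \ T) rfl (fun y hy => ?_) (fun y hy => ?_) x
        (Finset.mem_sdiff.2 ⟨hx, hxT⟩)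
      · obtain ⟨h1, h2⟩ := Finset.mem_sdiff.1 hy
        exact Finset.mem_sdiff.2 ⟨hU y h1, fun h => h2 (hback y h)⟩
      · obtain ⟨h1, h2⟩ := Finset.mem_sdiff.1 hy
        exact Finset.mem_sdiff.2 ⟨hU' y h1, fun h => h2 (hback' y h)⟩
  ext x
  exact key _ Finset.univ rfl (fun _ _ => Finset.mem_univ _) (fun _ _ => Finset.mem_univ _) x
    (Finset.mem_univ x)

section ChainUnion

variable {ℓ : ℕ} {a : Fin ℓ → ℕ}

theorem ChainUnion.comparable_of_fst_eq {x y : ChainUnion a} (h : x.1 = y.1) : x ≤ y ∨ y ≤ x := by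
  obtain ⟨i, k⟩ := x
  obtain ⟨j, m⟩ := y
  obtain rfl : i = j := h
  rcases le_total k m with h | h
  · exact Or.inl (Sigma.LE.fiber _ _ _ h)
  · exact Or.inr (Sigma.LE.fiber _ _ _ h)

/-- A transverse permutation of a disjoint union of chains is determined by the chains
of its values. -/
theorem TransversePerm.eq_of_fst_eq {τ τ' : TransversePerm (ChainUnion a)}
    (h : ∀ x, (τ.1 x).1 = (τ'.1 x).1) : τ = τ' := by
  obtain ⟨f, hf, hfm⟩ := (isTransversePartition_iff τ.1).1 τ.2
  obtain ⟨f', hf', hfm'⟩ := (isTransversePartition_iff τ'.1).1 τ'.2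
  exact Subtype.ext (perm_eq_of_strictMono_invariant hf hfm hf' hfm' fun x =>
    ChainUnion.comparable_of_fst_eq (h x))

/-! ### Linear extensions and words -/

theorem count_ofFn {α : Type*} [DecidableEq α] {n : ℕ} (f : Fin n → α) (i : α) :
    (List.ofFn f).count i = ∑ k, if f k = i then 1 else 0 := by
  induction n with
  | zero => simp
  | succ n ih =>
    rw [List.ofFn_succ, List.count_cons, ih, Fin.sum_univ_succ, add_comm]
    simp

theorem sum_ite_fst_perm {β : Type*} [Fintype β] (e : β ≃ ChainUnion a) (i : Fin ℓ) :
    (∑ x, if (e x).1 = i then 1 else 0) = a i := by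
  rw [e.sum_comp fun x : ChainUnion a => if x.1 = i then 1 else 0, Fintype.sum_sigma,
    Finset.sum_congr rfl (g := fun j => if j = i then a j else 0)]
  · simp
  · intro j _
    by_cases h : j = i <;> simp [h]

/-- Positions increase along a chain, so its `k`-th element must stand at the `k`-th occurrence of
its letter. This recovers the linear extension and also constructs one from any word. -/
theorem bijOn_multisetWord {n : ℕ} (ha : ∑ i, a i = n) :
    Set.BijOn (multisetWord (n := n) (a := a)) Set.univ (multisetPerms a) := by
  refine ⟨fun σ _ i => ?_, fun σ _ σ' _ h => ?_, fun w hw => ?_⟩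
  · rw [multisetWord, count_ofFn]
    exact sum_ite_fst_perm σ.1 i
  · have hfst : ∀ k, (σ.1 k).1 = (σ'.1 k).1 := congrFun (List.ofFn_injective h)
    have hmono : ∀ (σ : LinExt n (ChainUnion a)) (i : Fin ℓ),
        StrictMono fun k : Fin (a i) => σ.1.symm ⟨i, k⟩ := fun σ i k m hkm =>
      σ.2 _ _ (Sigma.LT.fiber _ _ _ hkm)
    have hrange : ∀ (σ : LinExt n (ChainUnion a)) (i : Fin ℓ),
        Set.range (fun k : Fin (a i) => σ.1.symm ⟨i, k⟩) = {k | (σ.1 k).1 = i} := by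
      intro σ i
      ext k
      constructor
      · rintro ⟨m, rfl⟩
        simp
      · rintro rfl
        exact ⟨(σ.1 k).2, σ.1.symm_apply_apply k⟩
    have hsymm : ∀ x, σ.1.symm x = σ'.1.symm x := by
      rintro ⟨i, k⟩
      have : (fun k : Fin (a i) => σ.1.symm ⟨i, k⟩) = fun k => σ'.1.symm ⟨i, k⟩ := by
        rw [← StrictMono.range_inj (hmono σ i) (hmono σ' i), hrange, hrange]
        simp only [hfst]
      exact congrFun this k
    exact Subtype.ext (Equiv.symm_bijective.injective (Equiv.ext hsymm))
  · have hlen : w.length = n := by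
      rw [← ha, ← Finset.sum_congr rfl fun i _ => hw i]
      simpa using (Multiset.sum_count_eq_card (s := Finset.univ) (m := (w : Multiset (Fin ℓ)))
        fun _ _ => Finset.mem_univ _).symm
    subst hlen
    let s : Fin ℓ → Finset (Fin w.length) := fun i => Finset.univ.filter fun k => w.get k = i
    have hs : ∀ i, (s i).card = a i := fun i => by
      rw [← hw i, Finset.card_filter, ← count_ofFn, List.ofFn_get]
    let F : ChainUnion a → Fin w.length := fun x => (s x.1).orderEmbOfFin (hs x.1) x.2
    have hF : ∀ x, w.get (F x) = x.1 := fun x =>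
      (Finset.mem_filter.1 ((s x.1).orderEmbOfFin_mem (hs x.1) x.2)).2
    have hbij : Function.Bijective F := by
      constructor
      · rintro ⟨i, k⟩ ⟨j, m⟩ h
        obtain rfl : i = j := by
          have h1 := hF ⟨i, k⟩
          rw [h, hF] at h1
          exact h1.symm
        exact congrArg (Sigma.mk i) (((s i).orderEmbOfFin (hs i)).injective h)
      · intro k
        have : k ∈ Set.range ((s (w.get k)).orderEmbOfFin (hs _)) := by
          rw [Finset.range_orderEmbOfFin]
          exact Finset.mem_coe.2 (Finset.mem_filter.2 ⟨Finset.mem_univ _, rfl⟩)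
        obtain ⟨m, hm⟩ := this
        exact ⟨⟨w.get k, m⟩, hm⟩
    let e := Equiv.ofBijective F hbij
    refine ⟨⟨e.symm, fun x y hxy => ?_⟩, Set.mem_univ _, ?_⟩
    · rw [Equiv.symm_symm]
      obtain ⟨i, k, m, hkm⟩ := hxy
      exact ((s i).orderEmbOfFin (hs i)).strictMono hkm
    · refine Eq.trans (congrArg List.ofFn (funext fun k => ?_)) (List.ofFn_get w)
      rw [← hF (e.symm k)]
      exact congrArg w.get (e.apply_symm_apply k)

/-! ### Words and transverse permutations -/

/-- The chain of the value of `τ` at the `k`-th element of the `i`-th chain is the `k`-th entry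
of the `i`-th row of `w`. -/
def IsRowPerm (w : List (Fin ℓ)) (τ : Equiv.Perm (ChainUnion a)) : Prop :=
  ∀ x, (row w x.1)[x.2.1]? = some (τ x).1

theorem IsRowPerm.word_eq {w w' : List (Fin ℓ)} {τ : Equiv.Perm (ChainUnion a)}
    (hw : w ∈ multisetPerms a) (hw' : w' ∈ multisetPerms a) (h : IsRowPerm w τ)
    (h' : IsRowPerm w' τ) : w = w' := by
  refine row_injective fun i => List.ext_getElem? fun k => ?_
  by_cases hk : k < a i
  · exact (h ⟨i, k, hk⟩).trans (h' ⟨i, k, hk⟩).symm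
  · rw [List.getElem?_eq_none (by rw [length_row, hw i]; omega),
      List.getElem?_eq_none (by rw [length_row, hw' i]; omega)]

/-- Balance holds because a bijection takes exactly `a i` values in chain `i`. -/
theorem exists_isRowPerm_word (τ : Equiv.Perm (ChainUnion a)) :
    ∃ w ∈ multisetPerms a, IsRowPerm w τ := by
  obtain ⟨w, hw⟩ := exists_row_eq (fun i => List.ofFn fun k : Fin (a i) => (τ ⟨i, k⟩).1) fun i => by
    rw [List.length_ofFn, ← sum_ite_fst_perm τ i, Fintype.sum_sigma]
    exact Finset.sum_congr rfl fun j _ => count_ofFn _ _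
  refine ⟨w, fun i => ?_, fun x => ?_⟩
  · rw [← length_row, hw, List.length_ofFn]
  · rw [hw]
    simp

/-- A decomposition into `m` prime cycles yields a transverse permutation with `m` cycles. -/
theorem IsPrimeDecomposition.exists_transversePerm {w : List (Fin ℓ)} {L : List (List (Fin ℓ))}
    (hL : IsPrimeDecomposition w L) (hw : w ∈ multisetPerms a) :
    ∃ τ : TransversePerm (ChainUnion a), IsRowPerm w τ.1 ∧ cyc τ.1 = L.length := by
  have hprime : ∀ m : Fin L.length, IsPrimeCycle (L.get m) := fun m => hL.1 _ (L.get_mem m)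
  choose g S hS hrow using fun m => (hprime m).exists_isMinimalClosed
  -- The factors containing the letter `i`, in order; this list is aligned with row `i` of `w`.
  let factors : Fin ℓ → List (Fin L.length) := fun i =>
    (List.finRange L.length).filter fun m => i ∈ S m
  have hrow' : ∀ i, row w i = (factors i).map fun m => g m i := by
    intro i
    rw [hL.2, row_foldr_intercalation]
    conv_lhs => rw [← List.map_get_finRange L]
    rw [List.flatMap_map]
    have : ∀ M : List (Fin L.length), (M.flatMap fun m => row (L.get m) i) =
        (M.filter fun m => i ∈ S m).map fun m => g m i := by
      intro M
      induction M with
      | nil => rfl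
      | cons m M ih =>
        rw [List.flatMap_cons, ih, hrow, List.filter_cons]
        split_ifs <;> simp_all
    exact this _
  have hlen : ∀ i, (factors i).length = a i := fun i => by
    rw [← hw i, ← length_row, hrow', List.length_map]
  have hsorted : ∀ i, (factors i).Pairwise (· < ·) := fun i =>
    (List.pairwise_lt_finRange _).filter _
  let o : ChainUnion a → Fin L.length := fun x =>
    (factors x.1)[x.2.1]'(by rw [hlen]; exact x.2.2)
  have ho : ∀ x, x.1 ∈ S (o x) := fun x => by
    have : o x ∈ factors x.1 := List.getElem_mem _
    simpa using (List.mem_filter.1 this).2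
  have homono : StrictMono o := by
    rintro x y ⟨i, k, m, hkm⟩
    exact List.pairwise_iff_getElem.1 (hsorted i) _ _ _ _ hkm
  -- An element is encoded by its factor and its letter; `G` below advances the letter one step
  -- along the cycle of its factor.
  let F : ChainUnion a → {p : Fin L.length × Fin ℓ // p.2 ∈ S p.1} := fun x => ⟨(o x, x.1), ho x⟩
  have hF : Function.Bijective F := by
    constructor
    · intro x y h
      have h1 : o x = o y := congrArg (fun p => p.1.1) h
      have h2 : x.1 = y.1 := congrArg (fun p => p.1.2) h
      rcases ChainUnion.comparable_of_fst_eq h2 with h | h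
      · by_contra hne
        exact (homono (lt_of_le_of_ne h hne)).ne h1
      · by_contra hne
        exact (homono (lt_of_le_of_ne h (Ne.symm hne))).ne h1.symm
    · rintro ⟨⟨m, i⟩, hmi⟩
      have : m ∈ factors i := List.mem_filter.2 ⟨List.mem_finRange m, by simpa using hmi⟩
      obtain ⟨k, hk, hkm⟩ := List.getElem_of_mem this
      exact ⟨⟨i, k, by rw [← hlen]; exact hk⟩, Subtype.ext (Prod.ext hkm rfl)⟩
  let e := Equiv.ofBijective F hF
  let G : {p : Fin L.length × Fin ℓ // p.2 ∈ S p.1} → {p : Fin L.length × Fin ℓ // p.2 ∈ S p.1} :=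
    fun p => ⟨(p.1.1, g p.1.1 p.1.2), (hS p.1.1).map_mem _ p.2⟩
  have hG : Function.Bijective G := by
    rw [← Finite.injective_iff_bijective]
    rintro ⟨⟨m, i⟩, hi⟩ ⟨⟨m', i'⟩, hi'⟩ h
    obtain rfl : m = m' := congrArg (fun p => p.1.1) h
    have h2 : g m i = g m i' := congrArg (fun p => p.1.2) h
    exact Subtype.ext (Prod.ext rfl ((hS m).injOn hi hi' h2))
  let τ : Equiv.Perm (ChainUnion a) := (e.trans (Equiv.ofBijective G hG)).trans e.symm
  have hτ : ∀ x, F (τ x) = G (F x) := fun x => e.apply_symm_apply _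
  have hτo : ∀ x, o (τ x) = o x := fun x => congrArg (fun p => p.1.1) (hτ x)
  have hτfst : ∀ x, (τ x).1 = g (o x) x.1 := fun x => congrArg (fun p => p.1.2) (hτ x)
  have htrans : IsTransversePartition (Equiv.Perm.SameCycle.setoid τ) := by
    rw [isTransversePartition_iff]
    refine ⟨fun x => ((o x : ℕ) : ℝ), fun x => congrArg (fun m : Fin _ => ((m : ℕ) : ℝ)) (hτo x),
      fun x y hxy => ?_⟩
    exact Nat.cast_lt.2 (homono hxy)
  refine ⟨⟨τ, htrans⟩, fun x => ?_, ?_⟩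
  · rw [hrow', List.getElem?_map, List.getElem?_eq_getElem (by rw [hlen]; exact x.2.2), hτfst]
    rfl
  · have hsame : ∀ x y, o x = o y → τ.SameCycle x y := by
      classical
      intro x y hxy
      -- The letters whose element in this factor lies on the cycle of `x` form a nonempty closed
      -- set, which by minimality is the whole factor.
      let T := (S (o x)).filter fun j => ∀ z, o z = o x → z.1 = j → τ.SameCycle x z
      have hT : T = S (o x) := by
        refine (hS (o x)).eq_of_subset T (Finset.filter_subset _ _) ⟨x.1, ?_⟩ ?_
        · refine Finset.mem_filter.2 ⟨ho x, fun z hz hz' => ?_⟩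
          have : z = x := hF.1 (Subtype.ext (Prod.ext hz hz'))
          rw [this]
        · intro j hj
          obtain ⟨hjS, hj⟩ := Finset.mem_filter.1 hj
          refine Finset.mem_filter.2 ⟨(hS _).map_mem _ hjS, fun z hz hz' => ?_⟩
          obtain ⟨t, ht⟩ := hF.2 ⟨(o x, j), hjS⟩
          have ht1 : o t = o x := congrArg (fun p => p.1.1) ht
          have ht2 : t.1 = j := congrArg (fun p => p.1.2) ht
          have hzt : z = τ t := hF.1 (by
            rw [hτ, ht]
            exact Subtype.ext (Prod.ext hz hz'))
          rw [hzt]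
          exact Equiv.Perm.sameCycle_apply_right.2 (hj t ht1 ht2)
      have hy : y.1 ∈ T := by
        rw [hT, hxy]
        exact ho y
      exact (Finset.mem_filter.1 hy).2 y hxy.symm rfl
    have hbij : Function.Bijective (Quotient.lift o fun x y hxy =>
        comp_perm_eq_of_sameCycle hτo hxy :
          Quotient (Equiv.Perm.SameCycle.setoid τ) → Fin L.length) := by
      constructor
      · intro p q
        induction p using Quotient.inductionOn
        induction q using Quotient.inductionOn
        exact fun h => Quotient.sound (hsame _ _ h)
      · intro m
        obtain ⟨i, hi⟩ := (hS m).nonempty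
        obtain ⟨x, hx⟩ := hF.2 ⟨(m, i), hi⟩
        exact ⟨Quotient.mk _ x, congrArg (fun p => p.1.1) hx⟩
    rw [cyc, Nat.card_eq_of_bijective _ hbij, Nat.card_eq_fintype_card, Fintype.card_fin]

theorem IsRowPerm.transversePerm_eq {w : List (Fin ℓ)} {τ τ' : TransversePerm (ChainUnion a)}
    (h : IsRowPerm w τ.1) (h' : IsRowPerm w τ'.1) : τ = τ' :=
  TransversePerm.eq_of_fst_eq fun x => Option.some_injective _ ((h x).symm.trans (h' x))

/-- Uniqueness in Foata's theorem: both decompositions yield transverse permutations matching the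
same rows, and rigidity identifies them. -/
theorem IsPrimeDecomposition.length_eq {w : List (Fin ℓ)} {L L' : List (List (Fin ℓ))}
    (hL : IsPrimeDecomposition w L) (hL' : IsPrimeDecomposition w L') : L.length = L'.length := by
  have hw : w ∈ multisetPerms fun i => w.count i := fun _ => rfl
  obtain ⟨τ, hτ, hc⟩ := hL.exists_transversePerm hw
  obtain ⟨τ', hτ', hc'⟩ := hL'.exists_transversePerm hw
  rw [← hc, ← hc', hτ.transversePerm_eq hτ']

theorem IsPrimeDecomposition.length_eq_fcyc {w : List (Fin ℓ)} {L : List (List (Fin ℓ))}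
    (hL : IsPrimeDecomposition w L) : L.length = fcyc w := by
  -- The given `L` makes the set nonempty, so the infimum is attained.
  obtain ⟨L', hL', h⟩ := Nat.sInf_mem (s := {k | ∃ L, IsPrimeDecomposition w L ∧ L.length = k})
    ⟨_, L, hL, rfl⟩
  rw [fcyc, ← h]
  exact hL.length_eq hL'

theorem exists_transversePerm_of_mem {w : List (Fin ℓ)} (hw : w ∈ multisetPerms a) :
    ∃ τ : TransversePerm (ChainUnion a), IsRowPerm w τ.1 ∧ cyc τ.1 = fcyc w := by
  obtain ⟨L, hL⟩ := exists_isPrimeDecomposition w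
  rw [← hL.length_eq_fcyc]
  exact hL.exists_transversePerm hw

end ChainUnion

theorem theorem1p3 {ℓ n : ℕ} (a : Fin ℓ → ℕ) (ha : ∑ i, a i = n) :
    -- linear extensions are identified with multiset permutations
    Set.BijOn (multisetWord (n := n) (a := a)) Set.univ (multisetPerms a) ∧
    -- the number of prime cycles is well defined
    (∀ σ : LinExt n (ChainUnion a),
      (∃ L, IsPrimeDecomposition (multisetWord σ) L) ∧
      ∀ L, IsPrimeDecomposition (multisetWord σ) L → L.length = fcyc (multisetWord σ)) ∧
    -- the bijection
    (∃ φ : LinExt n (ChainUnion a) → TransversePerm (ChainUnion a),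
      Function.Bijective φ ∧ ∀ σ, cyc (φ σ).1 = fcyc (multisetWord σ)) ∧
    -- the Poincaré polynomial
    poin (ChainUnion a) =
      ∑ σ : LinExt n (ChainUnion a), Polynomial.X ^ (n - fcyc (multisetWord σ)) := by
  have hbij := bijOn_multisetWord ha
  have hmem : ∀ σ : LinExt n (ChainUnion a), multisetWord σ ∈ multisetPerms a := fun σ =>
    hbij.mapsTo (Set.mem_univ σ)
  choose φ hφ hcyc using fun σ : LinExt n (ChainUnion a) => exists_transversePerm_of_mem (hmem σ)
  have hφbij : Function.Bijective φ := by
    constructor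
    · intro σ σ' h
      refine hbij.injOn (Set.mem_univ _) (Set.mem_univ _)
        ((hφ σ).word_eq (hmem σ) (hmem σ') ?_)
      rw [h]
      exact hφ σ'
    · intro τ
      -- Read a word off `τ`. The permutation built from that word matches the same rows, so
      -- rigidity returns `τ`.
      obtain ⟨w, hw, hwτ⟩ := exists_isRowPerm_word τ.1
      obtain ⟨σ, -, rfl⟩ := hbij.surjOn hw
      exact ⟨σ, (hφ σ).transversePerm_eq hwτ⟩
  refine ⟨hbij, fun σ => ⟨exists_isPrimeDecomposition _, fun L hL => hL.length_eq_fcyc⟩,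
    ⟨φ, hφbij, hcyc⟩, ?_⟩
  have : Fintype (TransversePerm (ChainUnion a)) :=
    Fintype.ofBijective φ hφbij
  have hcard : Fintype.card (ChainUnion a) = n := by
    rw [Fintype.card_sigma, ← ha]
    simp
  rw [poin_eq_sum_transversePerm, hcard]
  exact (Fintype.sum_bijective φ hφbij _ _ fun σ => by rw [hcyc]).symm
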